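/- Let $\alpha\in(1/2,1)$, let $\mathrm{sgn}(0)=0$, and for $\kappa\in(0,1]$ let $\mathscr P_\kappa$ be the set of probability measures $\gamma$ on $\mathbb R$ with $\int|x|^\kappa\,\gamma(dx)<\infty$, with the distance $\mathbb W_\kappa(\gamma,\tilde\gamma)=\inf_\pi\int|x-y|^\kappa\,\pi(dx,dy)$, the infimum being over all couplings $\pi$ of $\gamma$ and $\tilde\gamma$. Put $$b(\gamma)=\int_{\mathbb R}\mathrm{sgn}(x)|x|^{1-\alpha}\,\gamma(dx).$$ (i) For all $\gamma,\tilde\gamma\in\mathscr P_{1-\alpha}$, $|b(\gamma)-b(\tilde\gamma)|\le 2^\alpha\,\mathbb W_{1-\alpha}(\gamma,\tilde\gamma)\le 2\,\mathbb W_{1-\alpha}(\gamma,\tilde\gamma)$. (ii) There exist $c>0$ and $\varrho>0$, depending only on $\alpha$, such that for every real random variable $L_1$ with $\mathbb E\,e^{i\xi L_1}=e^{-|\xi|^\alpha}$ ($\xi\in\mathbb R$) the following expectation is finite and $$c=\alpha\,\mathbb E\big[\mathrm{sgn}(c+\varrho L_1)\,|c+\varrho L_1|^{1-\alpha}\big].\qquad(*)$$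 (iii) Let $c,\varrho>0$ and $T>0$. The coefficients $b_t(x,\gamma)=b(\gamma)$ and $\sigma_t(x,\gamma)=\varrho$ are measurable on $[0,T]\times\mathbb R\times\mathscr P$ (with $\mathscr P$ the set of all probability measures on $\mathbb R$, and $b(\gamma):=0$ where the integral does not converge absolutely), and there are $\beta\in(0,1)$ with $2\beta+\alpha>2$, $K>1$ and $\eta\in(0,\alpha)$ with $\alpha+\eta=1$ such that for all $t\in[0,T]$, $x,y\in\mathbb R$, $\gamma,\tilde\gamma\in\mathscr P_\eta$, $$|b_t(x,\gamma)-b_t(y,\tilde\gamma)|\le K\big(\mathbb W_\eta(\gamma,\tilde\gamma)+\max\{|x-y|^\beta,|x-y|\}\big),\qquad |b_t(0,\delta_0)|\le K,$$ $$|\sigma_t(x,\gamma)-\sigma_t(y,\tilde\gamma)|\le K\big(|x-y|+\mathbb W_\eta(\gamma,\tilde\gamma)\big),\qquad K^{-1}\le\sigma_t(x,\gamma)^2\le K.$$ If moreover $(L_t)_{t\ge0}$ is a symmetric $\alpha$-stable Lévy process on $\mathbb R$ with $\mathbb E\,e^{i\xi L_t}=e^{-t|\xi|^\alpha}$ and $(*)$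 holds, then both $$X_t=\varrho L_t\qquad\text{and}\qquad X_t=c\,t^{1/\alpha}+\varrho L_t$$ are strong solutions on $[0,T]$ of the McKean–Vlasov equation $dX_t=b(\mathscr L_{X_t})\,dt+\varrho\,dL_t$, $X_0=0$, where $\mathscr L_{X_t}$ is the law of $X_t$, and $t\mapsto\mathscr L_{X_t}$ is for both a continuous map from $[0,T]$ to $(\mathscr P_{1-\alpha},\mathbb W_{1-\alpha})$. For every $t>0$ the two solutions differ at time $t$ at every sample point, and their laws at time $t$ are different. Hence neither pathwise uniqueness nor uniqueness in law holds in $\mathscr P_\eta$ if, in these conditions on the coefficients, the requirement $\alpha+\eta>1$ is relaxed to $\alpha+\eta=1$. -/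

import Mathlib

open MeasureTheory ProbabilityTheory Filter Set
open scoped NNReal ENNReal Topology

namespace StableMcKeanVlasov

noncomputable section

/-- The function `x ↦ sgn(x) |x|^κ` on the real line, with `sgn 0 = 0`. -/
def signedPow (κ x : ℝ) : ℝ := Real.sign x * |x| ^ κ

/-- The drift `b(γ) = ∫ sgn(x) |x|^(1-α) γ(dx)`. -/
def drift (α : ℝ) (γ : Measure ℝ) : ℝ := ∫ x, signedPow (1 - α) x ∂γ

/-- `γ` is a probability measure on `ℝ` with finite moment of order `κ`. -/
def HasMoment (κ : ℝ) (γ : Measure ℝ) : Prop :=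
  IsProbabilityMeasure γ ∧ Integrable (fun x : ℝ => |x| ^ κ) γ

/-- `π` is a coupling of `γ` and `γ'`. -/
def IsCoupling (π : Measure (ℝ × ℝ)) (γ γ' : Measure ℝ) : Prop :=
  π.map Prod.fst = γ ∧ π.map Prod.snd = γ'

/-- The `L^κ`-Wasserstein distance (`0 < κ ≤ 1`, without an outer root): the infimum over all
couplings of the integral of `|x - y|^κ`. It is finite between measures with moments of order
`κ`. -/
def wasserstein (κ : ℝ) (γ γ' : Measure ℝ) : ℝ≥0∞ :=
  ⨅ π : {π : Measure (ℝ × ℝ) // IsCoupling π γ γ'},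
    ∫⁻ z : ℝ × ℝ, ENNReal.ofReal (|z.1 - z.2| ^ κ) ∂π.1

/-- The regularity conditions on the coefficients of a one-dimensional McKean-Vlasov equation
`dX_t = b_t(X_t, Law X_t) dt + σ_t(X_t, Law X_t) dL_t`, `t ∈ [0, T]`, with Hölder exponent `β` in
space, Wasserstein order `η` and constant `K`. The relation between `η` and the index of the noise
is not part of this structure. -/
structure CoefficientBounds (T : ℝ≥0) (β η K : ℝ)
    (b σ : Iic T → ℝ → ProbabilityMeasure ℝ → ℝ) : Prop where
  measurable_b : Measurable fun p : Iic T × ℝ × ProbabilityMeasure ℝ => b p.1 p.2.1 p.2.2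
  measurable_σ : Measurable fun p : Iic T × ℝ × ProbabilityMeasure ℝ => σ p.1 p.2.1 p.2.2
  drift_bound : ∀ (t : Iic T) (x y : ℝ) (γ γ' : ProbabilityMeasure ℝ),
    HasMoment η (γ : Measure ℝ) → HasMoment η (γ' : Measure ℝ) →
      ENNReal.ofReal |b t x γ - b t y γ'| ≤
        ENNReal.ofReal K * (wasserstein η (γ : Measure ℝ) (γ' : Measure ℝ) +
          ENNReal.ofReal (max (|x - y| ^ β) |x - y|))
  drift_zero : ∀ (t : Iic T), |b t 0 ⟨Measure.dirac 0, inferInstance⟩| ≤ K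
  noise_bound : ∀ (t : Iic T) (x y : ℝ) (γ γ' : ProbabilityMeasure ℝ),
    HasMoment η (γ : Measure ℝ) → HasMoment η (γ' : Measure ℝ) →
      ENNReal.ofReal |σ t x γ - σ t y γ'| ≤
        ENNReal.ofReal K *
          (ENNReal.ofReal |x - y| + wasserstein η (γ : Measure ℝ) (γ' : Measure ℝ))
  noise_elliptic : ∀ (t : Iic T) (x : ℝ) (γ : ProbabilityMeasure ℝ),
    HasMoment η (γ : Measure ℝ) → K⁻¹ ≤ σ t x γ ^ 2 ∧ σ t x γ ^ 2 ≤ K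

/-- The path `f` is right-continuous on `[0, T)` and has left limits on `(0, T]`. -/
def IsCadlagOn (T : ℝ≥0) (f : ℝ≥0 → ℝ) : Prop :=
  (∀ t < T, ContinuousWithinAt f (Ici t) t) ∧ ∀ t ≤ T, ∃ l : ℝ, Tendsto f (𝓝[<] t) (𝓝 l)

/-- The random variable `Z` has the symmetric `α`-stable law with `E exp(i ξ Z) = exp(-t |ξ|^α)`. -/
def HasStableLaw {Ω : Type*} [MeasurableSpace Ω] (P : Measure Ω) (α t : ℝ) (Z : Ω → ℝ) : Prop :=
  Measurable Z ∧ ∀ ξ : ℝ, charFun (P.map Z) ξ = ((Real.exp (-(t * |ξ| ^ α)) : ℝ) : ℂ)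

/-- `L` is a one-dimensional symmetric `α`-stable Lévy process under `P`, normalised by
`E exp(i ξ L_t) = exp(-t |ξ|^α)`. -/
structure IsStableProcess {Ω : Type*} [MeasurableSpace Ω] (P : Measure Ω) (α : ℝ)
    (L : ℝ≥0 → Ω → ℝ) : Prop where
  measurable : ∀ t, Measurable (L t)
  start : ∀ᵐ ω ∂P, L 0 ω = 0
  indep : HasIndepIncrements L P
  law : ∀ s t : ℝ≥0, s ≤ t → HasStableLaw P α ((t : ℝ) - s) fun ω => L t ω - L s ω
  cadlag : ∀ᵐ ω ∂P, ∀ T, IsCadlagOn T fun t => L t ω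

/-- The σ-algebra generated by `L_s`, `s ≤ t`. -/
abbrev history {Ω : Type*} (L : ℝ≥0 → Ω → ℝ) (t : ℝ≥0) : MeasurableSpace Ω :=
  ⨆ s : Iic t, MeasurableSpace.comap (L s) inferInstance

/-- `X` is a strong solution on `[0, T]` of `dX_t = b(Law X_t) dt + ϱ dL_t`, `X_0 = x₀`, whose
time marginals form a continuous curve in the space of probability measures with finite moment of
order `κ`. Adaptedness is with respect to the augmentation of the filtration generated by `L` by
null sets: `X_t` agrees almost surely with a variable measurable with respect to `L_s`, `s ≤ t`.
The coefficient of the noise is constant, so its stochastic integral is `ϱ (L_t - L_0)`. -/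
structure IsStrongSolution {Ω : Type*} [MeasurableSpace Ω] (P : Measure Ω) (T : ℝ≥0)
    (κ : ℝ) (b : Measure ℝ → ℝ) (ϱ : ℝ) (L : ℝ≥0 → Ω → ℝ) (x₀ : ℝ) (X : ℝ≥0 → Ω → ℝ) : Prop where
  adapted : ∀ t ≤ T, AEStronglyMeasurable[history L t] (X t) P
  cadlag : ∀ᵐ ω ∂P, IsCadlagOn T fun t => X t ω
  moment : ∀ t ≤ T, HasMoment κ (P.map (X t))
  law_continuous : ∀ t ≤ T,
    Tendsto (fun s => wasserstein κ (P.map (X s)) (P.map (X t))) (𝓝[Iic T] t) (𝓝 0)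
  start : ∀ᵐ ω ∂P, X 0 ω = x₀
  drift_integrable : IntervalIntegrable (fun s : ℝ => b (P.map (X s.toNNReal))) volume 0 T
  equation : ∀ᵐ ω ∂P, ∀ t ≤ T,
    X t ω = x₀ + (∫ s in (0 : ℝ)..t, b (P.map (X s.toNNReal))) + ϱ * (L t ω - L 0 ω)

end

end StableMcKeanVlasov

/-!
The drift `b` is homogeneous of order `1 - α`, and the stable process is self-similar of index
`1 / α`. Along a curve `X_t = a t^(1/α) + ϱ L_t` the law of `X_t` is that of `t^(1/α) (a + ϱ L_1)`,
so `b(Law X_t) = t^((1-α)/α) E φ(a + ϱ L_1)` where `φ(x) = sgn(x) |x|^(1-α)`. Since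
`(1-α)/α + 1 = 1/α`, the integral of this drift over `[0, t]` is `α t^(1/α) E φ(a + ϱ L_1)`, and
`X` solves the equation started at `0` as soon as `a = α E φ(a + ϱ L_1)`
(`IsStableProcess.isStrongSolution`). The value `a = 0` is always admissible because the stable law
is symmetric and `φ` is odd, so every positive solution `a = c` destroys uniqueness; the two
laws at time `t` are told apart by their drifts.

A positive solution is found by homogeneity (`exists_pos_fixedPoint`): with `c = ϱ` the equation
reads `ϱ^α = α E φ(1 + Z)`, and the right-hand side is positive because `φ` is strictly increasing
and odd, hence `φ(1 + z) + φ(1 - z) > 0` for every `z`.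

The expectations are finite because `1 - α < α`: a stable law has tails of order `r^(-α)`, by the
bound of the tail of a law through its characteristic function near `0`
(`HasStableLaw.measureReal_lt_abs_le`). The Lipschitz bound of the drift is the integral over a
coupling of `|φ(x) - φ(y)| ≤ 2^α |x - y|^(1-α)`, a consequence of the concavity of
`x ↦ x^(1-α)` on the half-line.
-/

namespace StableMcKeanVlasov

/-! ### The signed power -/

lemma abs_signedPow {κ : ℝ} (hκ : 0 < κ) (x : ℝ) : |signedPow κ x| = |x| ^ κ := by
  rcases eq_or_ne x 0 with rfl | hx
  · simp [signedPow, Real.zero_rpow hκ.ne']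
  · have : |Real.sign x| = 1 := by
      rcases Real.sign_apply_eq_of_ne_zero x hx with h | h <;> simp [h]
    rw [signedPow, abs_mul, this, one_mul, abs_of_nonneg (by positivity)]

lemma signedPow_of_nonneg {κ x : ℝ} (hκ : 0 < κ) (hx : 0 ≤ x) : signedPow κ x = x ^ κ := by
  rcases hx.eq_or_lt with rfl | hx
  · simp [signedPow, Real.zero_rpow hκ.ne']
  · simp [signedPow, Real.sign_of_pos hx, abs_of_pos hx]

lemma signedPow_neg (κ x : ℝ) : signedPow κ (-x) = -signedPow κ x := by
  simp [signedPow, Real.sign_neg]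

lemma signedPow_mul {κ a : ℝ} (hκ : 0 < κ) (ha : 0 ≤ a) (x : ℝ) :
    signedPow κ (a * x) = a ^ κ * signedPow κ x := by
  wlog hx : 0 ≤ x generalizing x
  · have h := this (-x) (by linarith)
    rw [mul_neg, signedPow_neg, signedPow_neg] at h
    linarith
  rw [signedPow_of_nonneg hκ hx, signedPow_of_nonneg hκ (mul_nonneg ha hx), Real.mul_rpow ha hx]

lemma measurable_signedPow (κ : ℝ) : Measurable (signedPow κ) := by
  have hs : Measurable Real.sign := by
    unfold Real.sign
    exact Measurable.ite measurableSet_Iio measurable_const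
      (Measurable.ite measurableSet_Ioi measurable_const measurable_const)
  exact hs.mul (by fun_prop)

lemma strictMono_signedPow {κ : ℝ} (hκ : 0 < κ) : StrictMono (signedPow κ) := by
  intro x y hxy
  rcases le_or_gt 0 x with hx | hx
  · rw [signedPow_of_nonneg hκ hx, signedPow_of_nonneg hκ (hx.trans hxy.le)]
    exact Real.rpow_lt_rpow hx hxy hκ
  · have hx' : signedPow κ x = -(-x) ^ κ := by
      rw [← signedPow_of_nonneg hκ (by linarith), signedPow_neg, neg_neg]
    have hpos : 0 < (-x) ^ κ := Real.rpow_pos_of_pos (by linarith) κ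
    rcases le_or_gt 0 y with hy | hy
    · rw [hx', signedPow_of_nonneg hκ hy]
      linarith [Real.rpow_nonneg hy κ]
    · have hy' : signedPow κ y = -(-y) ^ κ := by
        rw [← signedPow_of_nonneg hκ (by linarith), signedPow_neg, neg_neg]
      rw [hx', hy', neg_lt_neg_iff]
      exact Real.rpow_lt_rpow (by linarith) (by linarith) hκ

/-- The concavity of `x ↦ x ^ κ` at the midpoint of `a` and `b`. -/
lemma rpow_add_rpow_le {κ a b : ℝ} (hκ : 0 < κ) (hκ' : κ ≤ 1) (ha : 0 ≤ a) (hb : 0 ≤ b) :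
    a ^ κ + b ^ κ ≤ 2 ^ (1 - κ) * (a + b) ^ κ := by
  have h := (Real.concaveOn_rpow hκ.le hκ').2 (mem_Ici.2 ha) (mem_Ici.2 hb)
    (by norm_num : (0 : ℝ) ≤ 1 / 2) (by norm_num : (0 : ℝ) ≤ 1 / 2) (by norm_num)
  simp only [smul_eq_mul] at h
  rw [← mul_add, ← mul_add, Real.mul_rpow (by norm_num) (by positivity)] at h
  have h2 : (2 : ℝ) ^ (1 - κ) = 2 * (1 / 2 : ℝ) ^ κ := by
    rw [Real.rpow_sub two_pos, Real.rpow_one, one_div, Real.inv_rpow two_pos.le]; rfl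
  rw [h2]
  linarith

/-- The signed power is Hölder continuous; the constant is attained at `y = -x`. -/
lemma abs_signedPow_sub_le {κ : ℝ} (hκ : 0 < κ) (hκ' : κ ≤ 1) (x y : ℝ) :
    |signedPow κ x - signedPow κ y| ≤ 2 ^ (1 - κ) * |x - y| ^ κ := by
  wlog hxy : y ≤ x generalizing x y
  · rw [abs_sub_comm, abs_sub_comm x]
    exact this y x (by linarith)
  have hmono := (strictMono_signedPow hκ).monotone hxy
  rw [abs_of_nonneg (by linarith), abs_of_nonneg (by linarith : 0 ≤ x - y)]
  -- On either half-line the signed power has increments bounded by subadditivity.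
  have key : ∀ u v : ℝ, 0 ≤ v → v ≤ u →
      signedPow κ u - signedPow κ v ≤ 2 ^ (1 - κ) * (u - v) ^ κ := by
    intro u v hv huv
    rw [signedPow_of_nonneg hκ hv, signedPow_of_nonneg hκ (hv.trans huv)]
    have h := Real.rpow_add_le_add_rpow (sub_nonneg.2 huv) hv hκ.le hκ'
    rw [sub_add_cancel] at h
    have h1 : (1 : ℝ) ≤ 2 ^ (1 - κ) := Real.one_le_rpow one_le_two (by linarith)
    have h2 : 0 ≤ (u - v) ^ κ := Real.rpow_nonneg (sub_nonneg.2 huv) κ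
    nlinarith
  rcases le_or_gt 0 y with hy | hy
  · exact key x y hy hxy
  rcases le_or_gt x 0 with hx | hx
  · have h := key (-y) (-x) (by linarith) (by linarith)
    rw [signedPow_neg, signedPow_neg] at h
    rw [show x - y = -y - -x by ring]
    linarith
  · have h := rpow_add_rpow_le hκ hκ' hx.le (neg_nonneg.2 hy.le)
    rw [← signedPow_of_nonneg hκ hx.le, ← signedPow_of_nonneg hκ (neg_nonneg.2 hy.le),
      signedPow_neg] at h
    simpa [sub_eq_add_neg] using h

/-! ### Wasserstein distance and drift -/

lemma wasserstein_map_le {Ω : Type*} [MeasurableSpace Ω] (P : Measure Ω) (κ : ℝ) {X Y : Ω → ℝ}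
    (hX : Measurable X) (hY : Measurable Y) :
    wasserstein κ (P.map X) (P.map Y) ≤ ∫⁻ ω, ENNReal.ofReal (|X ω - Y ω| ^ κ) ∂P := by
  have hXY : Measurable fun ω => (X ω, Y ω) := hX.prodMk hY
  have hπ : IsCoupling (P.map fun ω => (X ω, Y ω)) (P.map X) (P.map Y) :=
    ⟨Measure.map_map measurable_fst hXY, Measure.map_map measurable_snd hXY⟩
  exact (iInf_le _ ⟨_, hπ⟩).trans_eq (lintegral_map (by fun_prop) hXY)

lemma HasMoment.integrable_signedPow {κ : ℝ} (hκ : 0 < κ) {γ : Measure ℝ} (h : HasMoment κ γ) :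
    Integrable (signedPow κ) γ :=
  h.2.mono' (measurable_signedPow κ).aestronglyMeasurable
    (Eventually.of_forall fun x => (abs_signedPow hκ x).le)

lemma ofReal_abs_drift_sub_le {α : ℝ} (hα : 0 ≤ α) (hα' : α < 1) {γ γ' : Measure ℝ}
    (hγ : HasMoment (1 - α) γ) (hγ' : HasMoment (1 - α) γ') :
    ENNReal.ofReal |drift α γ - drift α γ'| ≤
      ENNReal.ofReal (2 ^ α) * wasserstein (1 - α) γ γ' := by
  have hκ : 0 < 1 - α := by linarith
  have hm := measurable_signedPow (1 - α)
  rw [wasserstein, ENNReal.mul_iInf_of_ne (by simp; positivity) ENNReal.ofReal_ne_top]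
  refine le_iInf fun ⟨π, h1, h2⟩ => ?_
  have i1 : Integrable (fun z : ℝ × ℝ => signedPow (1 - α) z.1) π := by
    have := hγ.integrable_signedPow hκ
    rw [← h1] at this
    exact this.comp_measurable measurable_fst
  have i2 : Integrable (fun z : ℝ × ℝ => signedPow (1 - α) z.2) π := by
    have := hγ'.integrable_signedPow hκ
    rw [← h2] at this
    exact this.comp_measurable measurable_snd
  have e1 : drift α γ = ∫ z, signedPow (1 - α) z.1 ∂π := by
    rw [drift, ← h1, integral_map measurable_fst.aemeasurable hm.aestronglyMeasurable]
  have e2 : drift α γ' = ∫ z, signedPow (1 - α) z.2 ∂π := by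
    rw [drift, ← h2, integral_map measurable_snd.aemeasurable hm.aestronglyMeasurable]
  rw [e1, e2, ← integral_sub i1 i2, ← Real.norm_eq_abs, ofReal_norm,
    ← lintegral_const_mul _ (by fun_prop)]
  refine (enorm_integral_le_lintegral_enorm _).trans (lintegral_mono fun z => ?_)
  rw [← ofReal_norm, Real.norm_eq_abs, ← ENNReal.ofReal_mul (by positivity)]
  have h := abs_signedPow_sub_le hκ (by linarith) z.1 z.2
  rw [sub_sub_cancel] at h
  exact ENNReal.ofReal_le_ofReal h

lemma ofReal_two_rpow_le {α : ℝ} (hα' : α < 1) : ENNReal.ofReal (2 ^ α) ≤ 2 := by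
  rw [ENNReal.ofReal_le_iff_le_toReal (by simp)]
  simpa using Real.rpow_le_rpow_of_exponent_le one_le_two hα'.le

lemma measurable_drift (α : ℝ) : Measurable fun γ : ProbabilityMeasure ℝ => drift α γ := by
  let k : Kernel (ProbabilityMeasure ℝ) ℝ := ⟨fun γ => (γ : Measure ℝ), measurable_subtype_coe⟩
  have : IsMarkovKernel k := ⟨fun γ => inferInstanceAs (IsProbabilityMeasure (γ : Measure ℝ))⟩
  exact ((measurable_signedPow (1 - α)).stronglyMeasurable.integral_kernel (κ := k)).measurable

lemma drift_dirac_zero (α : ℝ) : drift α (Measure.dirac 0) = 0 := by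
  simp [drift, signedPow]

/-- The coefficients `b` and `ϱ` satisfy the regularity conditions for every spatial Hölder
exponent, since neither depends on the spatial variable. -/
lemma coefficientBounds {α : ℝ} (hα : 0 ≤ α) (hα' : α < 1) (T : ℝ≥0) (β : ℝ) {ϱ K : ℝ}
    (hK : 2 ≤ K) (h1 : K⁻¹ ≤ ϱ ^ 2) (h2 : ϱ ^ 2 ≤ K) :
    CoefficientBounds T β (1 - α) K
      (fun _ _ γ => drift α (γ : Measure ℝ)) (fun _ _ _ => ϱ) where
  measurable_b := (measurable_drift α).comp (measurable_snd.comp measurable_snd)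
  measurable_σ := measurable_const
  drift_bound t x y γ γ' hγ hγ' := by
    refine (ofReal_abs_drift_sub_le hα hα' hγ hγ').trans ?_
    refine mul_le_mul' ((ofReal_two_rpow_le hα').trans ?_) le_self_add
    rw [← ENNReal.ofReal_ofNat]
    exact ENNReal.ofReal_le_ofReal hK
  drift_zero t := by
    change |drift α (Measure.dirac 0)| ≤ K
    rw [drift_dirac_zero, abs_zero]
    linarith
  noise_bound t x y γ γ' _ _ := by simp
  noise_elliptic t x γ _ := ⟨h1, h2⟩

/-! ### Moments, symmetry and scaling of stable laws -/

section StableLaw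

variable {Ω Ω' : Type*} [MeasurableSpace Ω] [MeasurableSpace Ω']
  {P : Measure Ω} {P' : Measure Ω'} {α : ℝ} {Z : Ω → ℝ} {W : Ω' → ℝ}

lemma HasStableLaw.neg {t : ℝ} (hZ : HasStableLaw P α t Z) :
    HasStableLaw P α t fun ω => -Z ω := by
  refine ⟨hZ.1.neg, fun ξ => ?_⟩
  have h := charFun_map_mul_comp (μ := P) hZ.1.aemeasurable (-1) ξ
  simp only [neg_mul, one_mul] at h
  rw [h, hZ.2, abs_neg]

variable [IsProbabilityMeasure P] [IsProbabilityMeasure P']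

/-- The tail of a stable law: on `[-2/r, 2/r]` the characteristic function differs from `1` by at
most `(2/r)^α`. -/
lemma HasStableLaw.measureReal_lt_abs_le (h : HasStableLaw P α 1 Z) (hα : 0 < α) {r : ℝ}
    (hr : 0 < r) : P.real {ω | r < |Z ω|} ≤ 2 * 2 ^ α * r ^ (-α) := by
  have : IsProbabilityMeasure (P.map Z) := Measure.isProbabilityMeasure_map h.1.aemeasurable
  have hset : P.real {ω | r < |Z ω|} = (P.map Z).real {x | r < |x|} := by
    rw [map_measureReal_apply h.1 (measurableSet_lt measurable_const (by fun_prop))]; rfl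
  rw [hset]
  refine (measureReal_abs_gt_le_integral_charFun hr).trans ?_
  have hb : ∀ t ∈ uIoc (-2 * r⁻¹) (2 * r⁻¹), ‖1 - charFun (P.map Z) t‖ ≤ (2 * r⁻¹) ^ α := by
    intro t ht
    rw [uIoc_of_le (by have := inv_pos.2 hr; linarith)] at ht
    have ht' : |t| ≤ 2 * r⁻¹ := abs_le.2 ⟨by linarith [ht.1], ht.2⟩
    rw [h.2 t, one_mul, ← Complex.ofReal_one, ← Complex.ofReal_sub, Complex.norm_real,
      Real.norm_eq_abs]
    have h0 : 0 ≤ |t| ^ α := by positivity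
    have h1 : Real.exp (-|t| ^ α) ≤ 1 := Real.exp_le_one_iff.2 (by linarith)
    have h2 := Real.add_one_le_exp (-|t| ^ α)
    rw [abs_of_nonneg (by linarith)]
    have h3 : |t| ^ α ≤ (2 * r⁻¹) ^ α := Real.rpow_le_rpow (abs_nonneg t) ht' hα.le
    linarith
  have hI := intervalIntegral.norm_integral_le_of_norm_le_const hb
  have hlen : |2 * r⁻¹ - -2 * r⁻¹| = 4 * r⁻¹ := by
    rw [abs_of_nonneg (by have := inv_pos.2 hr; linarith)]; ring
  rw [hlen] at hI
  calc 2⁻¹ * r * ‖∫ t in (-2 * r⁻¹)..(2 * r⁻¹), 1 - charFun (P.map Z) t‖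
      ≤ 2⁻¹ * r * ((2 * r⁻¹) ^ α * (4 * r⁻¹)) := by gcongr
    _ = 2 * (2 * r⁻¹) ^ α := by field_simp; ring
    _ = 2 * 2 ^ α * r ^ (-α) := by
      rw [Real.mul_rpow two_pos.le (inv_pos.2 hr).le, Real.inv_rpow hr.le, Real.rpow_neg hr.le]
      ring

/-- A stable law of index `α` has moments of all orders below `α`, by integration of its tail. -/
lemma HasStableLaw.lintegral_lt_top (h : HasStableLaw P α 1 Z) {κ : ℝ} (hκ : 0 < κ)
    (hκα : κ < α) : ∫⁻ ω, ENNReal.ofReal (|Z ω| ^ κ) ∂P < ∞ := by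
  have hα : 0 < α := hκ.trans hκα
  have hm := h.1
  rw [lintegral_rpow_eq_lintegral_meas_lt_mul P (f := fun ω => |Z ω|)
    (Eventually.of_forall fun ω => abs_nonneg _) (by fun_prop) hκ]
  refine ENNReal.mul_lt_top ENNReal.ofReal_lt_top ?_
  rw [← Ioc_union_Ioi_eq_Ioi (zero_le_one' ℝ)]
  refine (lintegral_union_le _ _ _).trans_lt (ENNReal.add_lt_top.2 ⟨?_, ?_⟩)
  · have hI : IntegrableOn (fun t : ℝ => t ^ (κ - 1)) (Ioc 0 1) :=
      (intervalIntegrable_iff_integrableOn_Ioc_of_le zero_le_one).1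
        (intervalIntegral.intervalIntegrable_rpow' (by linarith))
    refine lt_of_le_of_lt (lintegral_mono fun t => ?_) hI.lintegral_lt_top
    exact mul_le_of_le_one_left' prob_le_one
  · have hI : IntegrableOn (fun t : ℝ => 2 * 2 ^ α * t ^ (κ - 1 - α)) (Ioi 1) :=
      (integrableOn_Ioi_rpow_of_lt (by linarith) zero_lt_one).const_mul _
    refine lt_of_le_of_lt (setLIntegral_mono' measurableSet_Ioi fun t ht => ?_)
      hI.lintegral_lt_top
    have ht0 : (0 : ℝ) < t := zero_lt_one.trans ht
    rw [← ofReal_measureReal, ← ENNReal.ofReal_mul measureReal_nonneg]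
    refine ENNReal.ofReal_le_ofReal ?_
    rw [sub_eq_add_neg (κ - 1) α, Real.rpow_add ht0]
    have := mul_le_mul_of_nonneg_right (h.measureReal_lt_abs_le hα ht0)
      (Real.rpow_nonneg ht0.le (κ - 1))
    linarith

/-- Self-similarity: at `t = 0` both laws are the point mass at `0`. -/
lemma HasStableLaw.map_eq {t : ℝ} (ht : 0 ≤ t) (hα : 0 < α) (hZ : HasStableLaw P α t Z)
    (hW : HasStableLaw P' α 1 W) : P.map Z = P'.map fun ω => t ^ (1 / α) * W ω := by
  have : IsProbabilityMeasure (P.map Z) := Measure.isProbabilityMeasure_map hZ.1.aemeasurable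
  have hWm := hW.1
  have : IsProbabilityMeasure (P'.map fun ω => t ^ (1 / α) * W ω) :=
    Measure.isProbabilityMeasure_map (by fun_prop)
  refine Measure.ext_of_charFun (funext fun ξ => ?_)
  rw [hZ.2, charFun_map_mul_comp hWm.aemeasurable, hW.2, abs_mul,
    Real.mul_rpow (abs_nonneg _) (abs_nonneg _), abs_of_nonneg (Real.rpow_nonneg ht _),
    ← Real.rpow_mul ht, one_div_mul_cancel hα.ne', Real.rpow_one, one_mul]

lemma HasStableLaw.map_neg {t : ℝ} (hZ : HasStableLaw P α t Z) :
    P.map (fun ω => -Z ω) = P.map Z := by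
  have : IsProbabilityMeasure (P.map Z) := Measure.isProbabilityMeasure_map hZ.1.aemeasurable
  have : IsProbabilityMeasure (P.map fun ω => -Z ω) :=
    Measure.isProbabilityMeasure_map hZ.1.neg.aemeasurable
  exact Measure.ext_of_charFun (funext fun ξ => by rw [hZ.2, hZ.neg.2])

lemma HasStableLaw.integrable_abs_rpow (hZ : HasStableLaw P α 1 Z) {κ : ℝ} (hκ : 0 < κ)
    (hκ' : κ ≤ 1) (hκα : κ < α) (a b : ℝ) :
    Integrable (fun ω => |a + b * Z ω| ^ κ) P := by
  have hm := hZ.1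
  have hI : Integrable (fun ω => |Z ω| ^ κ) P := by
    refine ⟨(hm.abs.pow_const κ).aestronglyMeasurable, ?_⟩
    rw [hasFiniteIntegral_iff_ofReal (Eventually.of_forall fun ω => by positivity)]
    exact hZ.lintegral_lt_top hκ hκα
  refine ((integrable_const (|a| ^ κ)).add (hI.const_mul (|b| ^ κ))).mono'
    (((hm.const_mul b).const_add a).abs.pow_const κ).aestronglyMeasurable
    (Eventually.of_forall fun ω => ?_)
  rw [Real.norm_of_nonneg (by positivity)]
  calc |a + b * Z ω| ^ κ ≤ (|a| + |b * Z ω|) ^ κ := by gcongr; exact abs_add_le _ _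
    _ ≤ |a| ^ κ + |b * Z ω| ^ κ :=
      Real.rpow_add_le_add_rpow (abs_nonneg _) (abs_nonneg _) hκ.le hκ'
    _ = |a| ^ κ + |b| ^ κ * |Z ω| ^ κ := by
      rw [abs_mul, Real.mul_rpow (abs_nonneg _) (abs_nonneg _)]

lemma HasStableLaw.integrable_signedPow (hZ : HasStableLaw P α 1 Z) {κ : ℝ} (hκ : 0 < κ)
    (hκ' : κ ≤ 1) (hκα : κ < α) (a b : ℝ) :
    Integrable (fun ω => signedPow κ (a + b * Z ω)) P := by
  have hm := hZ.1
  exact (hZ.integrable_abs_rpow hκ hκ' hκα a b).mono'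
    ((measurable_signedPow κ).comp (by fun_prop)).aestronglyMeasurable
    (Eventually.of_forall fun x => (abs_signedPow hκ _).le)

lemma HasStableLaw.integral_comp_neg (hZ : HasStableLaw P α 1 Z) {f : ℝ → ℝ}
    (hf : Measurable f) : ∫ ω, f (-Z ω) ∂P = ∫ ω, f (Z ω) ∂P := by
  rw [← integral_map (φ := fun ω => -Z ω) hZ.1.neg.aemeasurable hf.aestronglyMeasurable,
    hZ.map_neg, integral_map hZ.1.aemeasurable hf.aestronglyMeasurable]

lemma HasStableLaw.integral_signedPow_eq_zero (hZ : HasStableLaw P α 1 Z) (κ b : ℝ) :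
    ∫ ω, signedPow κ (b * Z ω) ∂P = 0 := by
  have hm := measurable_signedPow κ
  have h := hZ.integral_comp_neg (f := fun z => signedPow κ (b * z)) (by fun_prop)
  simp only [mul_neg, signedPow_neg, integral_neg] at h
  linarith

/-- A positive shift makes the expectation of the signed power positive: the sum
`φ(a + z) + φ(a - z)` is positive for all `z`, and `Z` is symmetric. -/
lemma HasStableLaw.integral_signedPow_pos (hZ : HasStableLaw P α 1 Z) {κ : ℝ} (hκ : 0 < κ)
    (hκ' : κ ≤ 1) (hκα : κ < α) {a : ℝ} (ha : 0 < a) :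
    0 < ∫ ω, signedPow κ (a + Z ω) ∂P := by
  have hm := measurable_signedPow κ
  have i1 : Integrable (fun ω => signedPow κ (a + Z ω)) P := by
    simpa using hZ.integrable_signedPow hκ hκ' hκα a 1
  have i2 : Integrable (fun ω => signedPow κ (a + -Z ω)) P := by
    simpa using hZ.integrable_signedPow hκ hκ' hκα a (-1)
  have h := hZ.integral_comp_neg (f := fun z => signedPow κ (a + z)) (by fun_prop)
  have hpos : ∀ z, 0 < signedPow κ (a + z) + signedPow κ (a + -z) := by
    intro z
    have := strictMono_signedPow hκ (show -(a + -z) < a + z by linarith)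
    rw [signedPow_neg] at this
    linarith
  have hsum : 0 < ∫ ω, (signedPow κ (a + Z ω) + signedPow κ (a + -Z ω)) ∂P := by
    rw [integral_pos_iff_support_of_nonneg (fun ω => (hpos _).le) (i1.add i2)]
    have : Function.support (fun ω => signedPow κ (a + Z ω) + signedPow κ (a + -Z ω)) = univ :=
      eq_univ_of_forall fun ω => (hpos _).ne'
    rw [this]
    simp
  rw [integral_add i1 i2] at hsum
  linarith

/-- By homogeneity, `c = ϱ` solves the equation for `c` as soon as `ϱ ^ α = α E φ(1 + Z)`. -/
lemma HasStableLaw.exists_pos_fixedPoint (hZ : HasStableLaw P α 1 Z) (hα : 1 / 2 < α)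
    (hα' : α < 1) :
    ∃ ϱ : ℝ, 0 < ϱ ∧ ϱ = α * ∫ ω, signedPow (1 - α) (ϱ + ϱ * Z ω) ∂P := by
  have hα0 : 0 < α := by linarith
  set g := ∫ ω, signedPow (1 - α) (1 + Z ω) ∂P with hg
  have hg0 : 0 < g :=
    hZ.integral_signedPow_pos (by linarith) (by linarith) (by linarith) one_pos
  have hρ : 0 < (α * g) ^ (1 / α) := Real.rpow_pos_of_pos (mul_pos hα0 hg0) _
  refine ⟨(α * g) ^ (1 / α), hρ, ?_⟩
  have hρα : ((α * g) ^ (1 / α)) ^ α = α * g := by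
    rw [← Real.rpow_mul (mul_pos hα0 hg0).le, one_div_mul_cancel hα0.ne', Real.rpow_one]
  set ϱ := (α * g) ^ (1 / α)
  have : ∀ ω, signedPow (1 - α) (ϱ + ϱ * Z ω) = ϱ ^ (1 - α) * signedPow (1 - α) (1 + Z ω) := by
    intro ω
    rw [← signedPow_mul (by linarith) hρ.le, mul_add, mul_one]
  simp_rw [this]
  rw [integral_const_mul, ← hg, mul_left_comm, ← hρα, ← Real.rpow_add hρ, sub_add_cancel,
    Real.rpow_one]

end StableLaw

/-- The constants depend on `α` only, because a law is determined by its characteristic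
function. -/
lemma exists_pos_fixedPoint {α : ℝ} (hα : 1 / 2 < α) (hα' : α < 1) :
    ∃ c ϱ : ℝ, 0 < c ∧ 0 < ϱ ∧
      ∀ (Ω : Type*) [MeasurableSpace Ω] (P : Measure Ω) [IsProbabilityMeasure P] (Z : Ω → ℝ),
        HasStableLaw P α 1 Z →
          Integrable (fun ω => signedPow (1 - α) (c + ϱ * Z ω)) P ∧
          c = α * ∫ ω, signedPow (1 - α) (c + ϱ * Z ω) ∂P := by
  -- The existence of a stable law is not needed: without one, any constants will do.
  by_cases hex : ∃ μ : Measure ℝ, IsProbabilityMeasure μ ∧ HasStableLaw μ α 1 id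
  · obtain ⟨μ, hμp, hμ⟩ := hex
    obtain ⟨ϱ, hϱ, hfix⟩ := hμ.exists_pos_fixedPoint hα hα'
    refine ⟨ϱ, ϱ, hϱ, hϱ, fun Ω _ P _ Z hZ =>
      ⟨hZ.integrable_signedPow (by linarith) (by linarith) (by linarith) _ _, hfix.trans ?_⟩⟩
    have hlaw : P.map Z = μ := by
      have := hZ.map_eq zero_le_one (by linarith) hμ
      simpa using this
    have hm := measurable_signedPow (1 - α)
    rw [← hlaw, integral_map hZ.1.aemeasurable
      (Measurable.aestronglyMeasurable (by simp only [id]; fun_prop))]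
    rfl
  · refine ⟨1, 1, one_pos, one_pos, fun Ω _ P _ Z hZ => absurd ?_ hex⟩
    exact ⟨P.map Z, Measure.isProbabilityMeasure_map hZ.1.aemeasurable, measurable_id, by
      rw [Measure.map_id]; exact hZ.2⟩

/-! ### Self-similar solutions -/

lemma IsCadlagOn.const_mul_add {T : ℝ≥0} {f g : ℝ≥0 → ℝ} (hg : Continuous g)
    (hf : IsCadlagOn T f) (ϱ : ℝ) : IsCadlagOn T fun t => g t + ϱ * f t := by
  refine ⟨fun t ht => hg.continuousWithinAt.add (continuousWithinAt_const.mul (hf.1 t ht)),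
    fun t ht => ?_⟩
  obtain ⟨l, hl⟩ := hf.2 t ht
  exact ⟨g t + ϱ * l, (hg.continuousWithinAt.tendsto).add (hl.const_mul ϱ)⟩

namespace IsStableProcess

variable {Ω : Type*} [MeasurableSpace Ω] {P : Measure Ω} {α : ℝ}
  {L : ℝ≥0 → Ω → ℝ}

lemma hasStableLaw (hL : IsStableProcess P α L) (t : ℝ≥0) : HasStableLaw P α t (L t) := by
  refine ⟨hL.measurable t, ?_⟩
  have h : (fun ω => L t ω - L 0 ω) =ᵐ[P] L t := by
    filter_upwards [hL.start] with ω hω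
    rw [hω, sub_zero]
  rw [← Measure.map_congr h]
  simpa using (hL.law 0 t bot_le).2

variable [IsProbabilityMeasure P]

lemma map_eq (hL : IsStableProcess P α L) (hα : 0 < α) (t : ℝ≥0) :
    P.map (L t) = P.map fun ω => (t : ℝ) ^ (1 / α) * L 1 ω :=
  (hL.hasStableLaw t).map_eq t.coe_nonneg hα (by simpa using hL.hasStableLaw 1)

lemma lintegral_sub (hL : IsStableProcess P α L) (hα : 0 < α) (κ : ℝ) (s t : ℝ≥0) :
    ∫⁻ ω, ENNReal.ofReal (|L s ω - L t ω| ^ κ) ∂P =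
      ENNReal.ofReal ((|(s : ℝ) - t| ^ (1 / α)) ^ κ) * ∫⁻ ω, ENNReal.ofReal (|L 1 ω| ^ κ) ∂P := by
  wlog hst : t ≤ s generalizing s t
  · have h := this t s (le_of_not_ge hst)
    simp_rw [abs_sub_comm (t : ℝ), abs_sub_comm (L t _)] at h
    exact h
  have hst' : (0 : ℝ) ≤ (s : ℝ) - t := sub_nonneg.2 (by exact_mod_cast hst)
  have hlaw := (hL.law t s hst).map_eq hst' hα (by simpa using hL.hasStableLaw 1)
  have hm := hL.measurable
  rw [← lintegral_map (μ := P) (f := fun x => ENNReal.ofReal (|x| ^ κ))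
    (g := fun ω => L s ω - L t ω) (by fun_prop) (by fun_prop), hlaw,
    lintegral_map (by fun_prop) (by fun_prop), ← lintegral_const_mul _ (by fun_prop)]
  refine lintegral_congr fun ω => ?_
  rw [abs_mul, Real.mul_rpow (abs_nonneg _) (abs_nonneg _), ENNReal.ofReal_mul (by positivity),
    abs_of_nonneg (Real.rpow_nonneg hst' _), abs_of_nonneg hst']

/-- The law of `a t^(1/α) + ϱ L_t` is that of `t^(1/α) (a + ϱ L_1)`, and the drift is homogeneous
of order `1 - α`. -/
lemma drift_map (hL : IsStableProcess P α L) (hα : 0 < α) (hα' : α < 1) (a ϱ : ℝ) (t : ℝ≥0) :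
    drift α (P.map fun ω => a * (t : ℝ) ^ (1 / α) + ϱ * L t ω) =
      (t : ℝ) ^ ((1 - α) / α) * ∫ ω, signedPow (1 - α) (a + ϱ * L 1 ω) ∂P := by
  have hm := measurable_signedPow (1 - α)
  have hLm := hL.measurable
  have ht : (0 : ℝ) ≤ (t : ℝ) ^ (1 / α) := Real.rpow_nonneg t.coe_nonneg _
  rw [drift, integral_map (by fun_prop) hm.aestronglyMeasurable,
    ← integral_map (φ := L t) (f := fun x => signedPow (1 - α) (a * (t : ℝ) ^ (1 / α) + ϱ * x))
      (by fun_prop) (Measurable.aestronglyMeasurable (by fun_prop)), hL.map_eq hα,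
    integral_map (by fun_prop) (Measurable.aestronglyMeasurable (by fun_prop)),
    ← integral_const_mul]
  refine integral_congr_ae (Eventually.of_forall fun ω => ?_)
  have hexp : (t : ℝ) ^ ((1 - α) / α) = ((t : ℝ) ^ (1 / α)) ^ (1 - α) := by
    rw [← Real.rpow_mul t.coe_nonneg]; congr 1; ring
  simp only [hexp]
  rw [← signedPow_mul (by linarith) ht]
  congr 1
  ring

lemma hasMoment (hL : IsStableProcess P α L) {κ : ℝ} (hκ : 0 < κ) (hκ' : κ ≤ 1) (hκα : κ < α)
    (a ϱ : ℝ) (t : ℝ≥0) : HasMoment κ (P.map fun ω => a + ϱ * L t ω) := by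
  have hLm := hL.measurable
  refine ⟨Measure.isProbabilityMeasure_map (by fun_prop), ?_⟩
  have h1 : HasStableLaw P α 1 (L 1) := by simpa using hL.hasStableLaw 1
  have h2 : Integrable (fun ω => |a + ϱ * ((t : ℝ) ^ (1 / α) * L 1 ω)| ^ κ) P := by
    simpa only [mul_assoc] using h1.integrable_abs_rpow hκ hκ' hκα a (ϱ * (t : ℝ) ^ (1 / α))
  rw [integrable_map_measure (Measurable.aestronglyMeasurable (by fun_prop)) (by fun_prop)]
  have h3 : Integrable (fun x => |a + ϱ * x| ^ κ) (P.map (L t)) := by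
    rw [hL.map_eq (hκ.trans hκα),
      integrable_map_measure (Measurable.aestronglyMeasurable (by fun_prop)) (by fun_prop)]
    exact h2
  exact h3.comp_measurable (hLm t)

lemma tendsto_wasserstein (hL : IsStableProcess P α L) {κ : ℝ} (hκ : 0 < κ) (hκ' : κ ≤ 1)
    (hκα : κ < α) {f : ℝ≥0 → ℝ} (hf : Continuous f) (ϱ : ℝ) (t : ℝ≥0) :
    Tendsto (fun s => wasserstein κ (P.map fun ω => f s + ϱ * L s ω)
      (P.map fun ω => f t + ϱ * L t ω)) (𝓝 t) (𝓝 0) := by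
  have hα : 0 < α := hκ.trans hκα
  have hLm := hL.measurable
  set M := ∫⁻ ω, ENNReal.ofReal (|L 1 ω| ^ κ) ∂P
  have hM : M ≠ ∞ := by
    have h1 : HasStableLaw P α 1 (L 1) := by simpa using hL.hasStableLaw 1
    exact (h1.lintegral_lt_top hκ hκα).ne
  have hbound : ∀ s, wasserstein κ (P.map fun ω => f s + ϱ * L s ω)
      (P.map fun ω => f t + ϱ * L t ω) ≤ ENNReal.ofReal (|f s - f t| ^ κ) +
        ENNReal.ofReal (|ϱ| ^ κ) * (ENNReal.ofReal ((|(s : ℝ) - t| ^ (1 / α)) ^ κ) * M) := by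
    intro s
    refine (wasserstein_map_le P κ (by fun_prop) (by fun_prop)).trans ?_
    rw [← hL.lintegral_sub hα, ← lintegral_const_mul _ (by fun_prop)]
    have hc : ENNReal.ofReal (|f s - f t| ^ κ) =
        ∫⁻ _, ENNReal.ofReal (|f s - f t| ^ κ) ∂P := by simp
    rw [hc, ← lintegral_add_left measurable_const]
    refine lintegral_mono fun ω => ?_
    rw [← ENNReal.ofReal_mul (by positivity), ← ENNReal.ofReal_add (by positivity) (by positivity)]
    refine ENNReal.ofReal_le_ofReal ?_
    calc |f s + ϱ * L s ω - (f t + ϱ * L t ω)| ^ κ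
        = |(f s - f t) + ϱ * (L s ω - L t ω)| ^ κ := by congr 2; ring
      _ ≤ (|f s - f t| + |ϱ * (L s ω - L t ω)|) ^ κ := by gcongr; exact abs_add_le _ _
      _ ≤ |f s - f t| ^ κ + |ϱ * (L s ω - L t ω)| ^ κ :=
        Real.rpow_add_le_add_rpow (abs_nonneg _) (abs_nonneg _) hκ.le hκ'
      _ = |f s - f t| ^ κ + |ϱ| ^ κ * |L s ω - L t ω| ^ κ := by
        rw [abs_mul, Real.mul_rpow (abs_nonneg _) (abs_nonneg _)]
  refine tendsto_of_tendsto_of_tendsto_of_le_of_le tendsto_const_nhds ?_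
    (fun _ => bot_le) hbound
  have hα1 : 0 ≤ 1 / α := by positivity
  have c1 : Continuous fun s : ℝ≥0 => ENNReal.ofReal (|f s - f t| ^ κ) :=
    ENNReal.continuous_ofReal.comp
      ((hf.sub continuous_const).abs.rpow_const fun _ => Or.inr hκ.le)
  have c2 : Continuous fun s : ℝ≥0 => ENNReal.ofReal ((|(s : ℝ) - t| ^ (1 / α)) ^ κ) :=
    ENNReal.continuous_ofReal.comp
      ((((NNReal.continuous_coe.sub continuous_const).abs.rpow_const
        fun _ => Or.inr hα1)).rpow_const fun _ => Or.inr hκ.le)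
  have c3 : Continuous fun s : ℝ≥0 => ENNReal.ofReal (|f s - f t| ^ κ) +
      ENNReal.ofReal (|ϱ| ^ κ) * (ENNReal.ofReal ((|(s : ℝ) - t| ^ (1 / α)) ^ κ) * M) :=
    c1.add ((ENNReal.continuous_const_mul ENNReal.ofReal_ne_top).comp
      ((ENNReal.continuous_mul_const hM).comp c2))
  convert c3.tendsto t using 2
  simp [Real.zero_rpow hκ.ne', Real.zero_rpow (inv_pos.2 hα).ne']

/-- The self-similar solutions: the constant `a` in front of `t^(1/α)` is a fixed point of
`a ↦ α E φ(a + ϱ L_1)`. -/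
lemma isStrongSolution (hL : IsStableProcess P α L) (hα : 1 / 2 < α) (hα' : α < 1) {a ϱ : ℝ}
    (ha : a = α * ∫ ω, signedPow (1 - α) (a + ϱ * L 1 ω) ∂P) (T : ℝ≥0) :
    IsStrongSolution P T (1 - α) (drift α) ϱ L 0
      fun t ω => a * (t : ℝ) ^ (1 / α) + ϱ * L t ω := by
  have hα0 : 0 < α := by linarith
  have hα1 : 0 < 1 / α := by positivity
  have hcont : Continuous fun t : ℝ≥0 => a * (t : ℝ) ^ (1 / α) :=
    continuous_const.mul (NNReal.continuous_coe.rpow_const fun _ => Or.inr hα1.le)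
  set D := ∫ ω, signedPow (1 - α) (a + ϱ * L 1 ω) ∂P
  have hdrift : ∀ t : ℝ≥0, ∀ s ∈ uIcc (0 : ℝ) t,
      drift α (P.map fun ω => a * ((s.toNNReal : ℝ≥0) : ℝ) ^ (1 / α) + ϱ * L s.toNNReal ω) =
        s ^ ((1 - α) / α) * D := by
    intro t s hs
    rw [uIcc_of_le t.coe_nonneg] at hs
    rw [hL.drift_map hα0 hα' a ϱ, Real.coe_toNNReal s hs.1]
  have hr : 0 ≤ (1 - α) / α := div_nonneg (by linarith) hα0.le
  refine ⟨fun t _ => ?_, ?_, fun t _ => ?_, fun t _ => ?_, ?_, ?_, ?_⟩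
  · have hm : Measurable[history L t] (L t) := by
      refine Measurable.mono (comap_measurable (L t)) ?_ le_rfl
      exact le_iSup (fun s : Iic t => MeasurableSpace.comap (L s) inferInstance)
        (⟨t, mem_Iic.2 le_rfl⟩ : Iic t)
    exact ((hm.const_mul ϱ).const_add _).stronglyMeasurable.aestronglyMeasurable
  · filter_upwards [hL.cadlag] with ω hω
    exact (hω T).const_mul_add hcont ϱ
  · exact hL.hasMoment (by linarith) (by linarith) (by linarith) _ ϱ t
  · exact (hL.tendsto_wasserstein (by linarith) (by linarith) (by linarith) hcont ϱ t).mono_left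
      nhdsWithin_le_nhds
  · filter_upwards [hL.start] with ω hω
    simp [hω, hα0.ne']
  · refine IntervalIntegrable.congr_ae (f := fun s : ℝ => s ^ ((1 - α) / α) * D) ?_ ?_
    · exact (intervalIntegral.intervalIntegrable_rpow (Or.inl hr)).mul_const D
    · exact (ae_restrict_iff' measurableSet_uIoc).2
        (Eventually.of_forall fun s hs => (hdrift T s (uIoc_subset_uIcc hs)).symm)
  · filter_upwards [hL.start] with ω hω t _
    rw [intervalIntegral.integral_congr (hdrift t), intervalIntegral.integral_mul_const,
      integral_rpow (Or.inl (by linarith)), show (1 - α) / α + 1 = 1 / α by field_simp; ring,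
      Real.zero_rpow hα1.ne', hω]
    have hD : a = α * D := ha
    field_simp
    rw [hD]
    ring

end IsStableProcess

end StableMcKeanVlasov

open StableMcKeanVlasov
theorem mainTheorem2 (α : ℝ) (hα : 1 / 2 < α) (hα' : α < 1) :
    -- the drift is Lipschitz for the Wasserstein distance of order `1 - α`
    (∀ γ γ' : Measure ℝ,
      StableMcKeanVlasov.HasMoment (1 - α) γ → StableMcKeanVlasov.HasMoment (1 - α) γ' →
        ENNReal.ofReal |StableMcKeanVlasov.drift α γ - StableMcKeanVlasov.drift α γ'| ≤
            ENNReal.ofReal (2 ^ α) * StableMcKeanVlasov.wasserstein (1 - α) γ γ' ∧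
        ENNReal.ofReal (2 ^ α) * StableMcKeanVlasov.wasserstein (1 - α) γ γ' ≤
            2 * StableMcKeanVlasov.wasserstein (1 - α) γ γ') ∧
    -- constants solving the equation for `c` exist and depend on `α` only
    (∃ c ϱ : ℝ, 0 < c ∧ 0 < ϱ ∧
      ∀ (Ω : Type*) [MeasurableSpace Ω] (P : Measure Ω) [IsProbabilityMeasure P] (Z : Ω → ℝ),
        StableMcKeanVlasov.HasStableLaw P α 1 Z →
          Integrable (fun ω => StableMcKeanVlasov.signedPow (1 - α) (c + ϱ * Z ω)) P ∧
          c = α * ∫ ω, StableMcKeanVlasov.signedPow (1 - α) (c + ϱ * Z ω) ∂P) ∧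
    -- for such constants, the coefficients satisfy all the conditions with `α + η = 1`,
    -- and the equation started at `0` has two distinct strong solutions
    (∀ c ϱ : ℝ, 0 < c → 0 < ϱ → ∀ T : ℝ≥0, 0 < T →
      (∃ β ∈ Ioo (0 : ℝ) 1, 2 < 2 * β + α ∧ ∃ K : ℝ, 1 < K ∧ ∃ η ∈ Ioo (0 : ℝ) α, α + η = 1 ∧
        StableMcKeanVlasov.CoefficientBounds T β η K
          (fun _ _ γ => StableMcKeanVlasov.drift α (γ : Measure ℝ)) (fun _ _ _ => ϱ)) ∧
      ∀ (Ω : Type*) [MeasurableSpace Ω] (P : Measure Ω) [IsProbabilityMeasure P]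
        (L : ℝ≥0 → Ω → ℝ), StableMcKeanVlasov.IsStableProcess P α L →
        c = α * ∫ ω, StableMcKeanVlasov.signedPow (1 - α) (c + ϱ * L 1 ω) ∂P →
          StableMcKeanVlasov.IsStrongSolution P T (1 - α) (StableMcKeanVlasov.drift α) ϱ L 0
            (fun t ω => ϱ * L t ω) ∧
          StableMcKeanVlasov.IsStrongSolution P T (1 - α) (StableMcKeanVlasov.drift α) ϱ L 0
            (fun t ω => c * (t : ℝ) ^ (1 / α) + ϱ * L t ω) ∧
          ∀ t : ℝ≥0, 0 < t →
            (∀ ω, ϱ * L t ω ≠ c * (t : ℝ) ^ (1 / α) + ϱ * L t ω) ∧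
            P.map (fun ω => ϱ * L t ω) ≠
              P.map (fun ω => c * (t : ℝ) ^ (1 / α) + ϱ * L t ω)) := by
  refine ⟨fun γ γ' hγ hγ' => ⟨ofReal_abs_drift_sub_le (by linarith) hα' hγ hγ',
    mul_le_mul_left (ofReal_two_rpow_le hα') _⟩, exists_pos_fixedPoint hα hα',
    fun c ϱ hc hϱ T hT => ⟨?_, fun Ω _ P _ L hL hfix => ?_⟩⟩
  · have h1 : 0 < ϱ ^ 2 := by positivity
    have h2 : 0 < (ϱ ^ 2)⁻¹ := by positivity
    -- Any `β` in `(1 - α / 2, 1)` will do; the midpoint is taken.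
    refine ⟨1 - α / 4, ⟨by linarith, by linarith⟩, by linarith, 2 + ϱ ^ 2 + (ϱ ^ 2)⁻¹,
      by linarith, 1 - α, ⟨by linarith, by linarith⟩, by ring,
      coefficientBounds (by linarith) hα' T _ (by linarith) ?_ (by linarith)⟩
    exact inv_le_of_inv_le₀ h1 (by linarith)
  · have h1 : HasStableLaw P α 1 (L 1) := by simpa using hL.hasStableLaw 1
    have hzero := h1.integral_signedPow_eq_zero (1 - α) ϱ
    have hsol := hL.isStrongSolution (a := 0) (ϱ := ϱ) hα hα' (by simp [hzero]) T
    simp only [zero_mul, zero_add] at hsol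
    refine ⟨hsol, hL.isStrongSolution hα hα' hfix T, fun t ht => ?_⟩
    have ht' : (0 : ℝ) < t := by exact_mod_cast ht
    refine ⟨fun ω h => ?_, fun h => ?_⟩
    · have : 0 < c * (t : ℝ) ^ (1 / α) := by positivity
      linarith
    · have e1 := hL.drift_map (by linarith) hα' 0 ϱ t
      have e2 := hL.drift_map (by linarith) hα' c ϱ t
      simp only [zero_mul, zero_add, hzero, mul_zero] at e1
      rw [← h, e1] at e2
      have hD : ∫ ω, signedPow (1 - α) (c + ϱ * L 1 ω) ∂P = 0 :=
        (mul_eq_zero.1 e2.symm).resolve_left (Real.rpow_pos_of_pos ht' _).ne'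
      rw [hD, mul_zero] at hfix
      exact hc.ne' hfix
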